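/- A binary sequence of length $N\ge 1$ is $a=(a(0),\dots,a(N-1))$ with all $a(j)=\pm1$; its periodic autocorrelation function is $\tilde\varphi_a(i)=\sum_{j=0}^{N-1}a(j)\,a((i+j)\bmod N)$, $0\le i<N$. A $PCS_p^N$ ($p\ge1$) is a family of $p$ binary sequences of length $N$, not necessarily distinct, whose periodic autocorrelation functions sum to a $\delta$-function, i.e. $\sum_{r=1}^p\tilde\varphi_{a_r}(i)=0$ for $0<i<N$. Subsets $X_1,\dots,X_p\subseteq\mathbf Z/N$ are supplementary difference sets (SDS) with parameters $(N;k_1,\dots,k_p;\lambda)$ if $|X_r|=k_r$ for all $r$ and, for every nonzero $m\in\mathbf Z/N$, the total number over $r=1,\dots,p$ of ordered pairs $(i,j)\in X_r\times X_r$ with $i-j=m$ is $\lambda$. **Theorem (existence of $PCS_p^N$ for $p\le12$, $N\le50$).** 1. If $p\ge1$ is divisible by $4$, then $PCS_p^N$ exist for all $1\le N\le50$. For every $p\ge1$, $PCS_p^1$ exist. 2. If $p$ is not divisible by $4$, $N>1$ and $PCS_p^N$ exist, then $N$ is even. 3. For $p\le12$ not divisible by $4$ and even $N$ with $2\le N\le50$,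 $PCS_p^N$ exist if and only if $N$ is listed in row $p$ of the following table, either as a bullet entry or as a circle entry (all other entries of the table are blank: no $PCS_p^N$ exist). | $p$ | bullet entries $N$ | circle entries $N$ | |---|---|---| | 1 | 4 | none | | 2 | 2, 8, 10, 16, 20, 26, 32, 34, 40, 50 | 4 | | 3 | 8, 12, 16, 24, 28, 32, 36, 40, 44, 48 | 4 | | 5 | 12, 20, 24, 28, 36, 44, 48 | 4, 8, 16, 32, 40 | | 6 | 6, 14, 18, 22, 30, 38, 42, 46 | all other even $N\le50$ | | 7 | none | all multiples of 4 up to 48 | | 9 | none | all multiples of 4 up to 48 | | 10 | none | all even $N\le50$ | | 11 | none | all multiples of 4 up to 48 | Moreover, among the non-blank entries $(p,N)$, the circle entries are exactly those for which $p$ can be written as a sum of integers $q<p$ (repetitions allowed) such that each $q$ is $4$ or $(q,N)$ is a bullet entry, so that a $PCS_p^N$ arises by combining families $PCS_q^N$; a bullet entry admits no such decomposition. 4. There exist supplementary difference sets with parameters $(36;15,15,15;18)$, $(40;19,18,15;22)$, $(44;20,20,17;24)$, $(48;24,24,18;30)$, $(44;21,20,19,18,17;40)$, $(48;23,21,21,20,19;44)$,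 $(38;18,17,16,16,16,14;40)$, $(42;19,18,18,18,17,17;44)$ and $(46;21,21,21,21,21,16;52)$. -/

import Mathlib

namespace PeriodicComplementary

/-- A binary sequence of length `N`: every term is `1` or `-1`. -/
def IsBinary {N : ℕ} (a : Fin N → ℤ) : Prop :=
  ∀ j, a j = 1 ∨ a j = -1

/-- The periodic autocorrelation function; addition in `Fin N` is addition modulo `N`. -/
def pacf {N : ℕ} (a : Fin N → ℤ) (i : Fin N) : ℤ :=
  ∑ j, a j * a (i + j)

/-- A family of `p` periodic complementary binary sequences of length `N`: the sum of the periodic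
autocorrelation functions vanishes at every nonzero shift (at shift `0` it is always `p * N`).
The members of the family need not be distinct. -/
def IsPCS {p N : ℕ} (a : Fin p → Fin N → ℤ) : Prop :=
  (∀ r, IsBinary (a r)) ∧ ∀ i : Fin N, (i : ℕ) ≠ 0 → ∑ r, pacf (a r) i = 0

/-- `PCS_p^N` exist. -/
def ExistsPCS (p N : ℕ) : Prop :=
  ∃ a : Fin p → Fin N → ℤ, IsPCS a

/-- The number of ordered pairs of elements of `X` with difference `m` modulo `N`. -/
def nu {N : ℕ} (X : Finset (Fin N)) (m : Fin N) : ℕ :=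
  ((X ×ˢ X).filter fun ij => ij.1 - ij.2 = m).card

/-- Supplementary difference sets in `ℤ / N` with parameters `(N; k₁, …, kₚ; l)`. -/
def IsSDS {p N : ℕ} (X : Fin p → Finset (Fin N)) (k : Fin p → ℕ) (l : ℕ) : Prop :=
  (∀ r, (X r).card = k r) ∧ ∀ m : Fin N, (m : ℕ) ≠ 0 → ∑ r, nu (X r) m = l

/-- There are supplementary difference sets with parameters `(N; k₁, …, kₚ; l)`. -/
def ExistsSDS (N : ℕ) {p : ℕ} (k : Fin p → ℕ) (l : ℕ) : Prop :=
  ∃ X : Fin p → Finset (Fin N), IsSDS X k l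

/-- The three kinds of entries of the table. -/
inductive Entry
  | blank
  | bullet
  | circle
  deriving DecidableEq

/-- The columns with a bullet in row `p` of the table. -/
def bulletColumns : ℕ → List ℕ
  | 1 => [4]
  | 2 => [2, 8, 10, 16, 20, 26, 32, 34, 40, 50]
  | 3 => [8, 12, 16, 24, 28, 32, 36, 40, 44, 48]
  | 5 => [12, 20, 24, 28, 36, 44, 48]
  | 6 => [6, 14, 18, 22, 30, 38, 42, 46]
  | _ => []

/-- The columns with a circle in row `p` of the table. -/
def circleColumns : ℕ → List ℕ
  | 2 => [4]
  | 3 => [4]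
  | 5 => [4, 8, 16, 32, 40]
  | 6 => [2, 4, 8, 10, 12, 16, 20, 24, 26, 28, 32, 34, 36, 40, 44, 48, 50]
  | 7 => [4, 8, 12, 16, 20, 24, 28, 32, 36, 40, 44, 48]
  | 9 => [4, 8, 12, 16, 20, 24, 28, 32, 36, 40, 44, 48]
  | 10 => [2, 4, 6, 8, 10, 12, 14, 16, 18, 20, 22, 24, 26, 28, 30, 32, 34, 36, 38, 40, 42, 44,
      46, 48, 50]
  | 11 => [4, 8, 12, 16, 20, 24, 28, 32, 36, 40, 44, 48]
  | _ => []

/-- The entry of the table in row `p` and column `N`; the table has the rows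
`p = 1, 2, 3, 5, 6, 7, 9, 10, 11` and the columns `N = 2, 4, …, 50`. -/
def tableEntry (p N : ℕ) : Entry :=
  if N ∈ bulletColumns p then .bullet else if N ∈ circleColumns p then .circle else .blank

/-- `p` is a sum of numbers `q < p`, repetitions allowed, each of which is `4` or the row of a
bullet entry in column `N`. -/
def IsCombination (p N : ℕ) : Prop :=
  ∃ s : Multiset ℕ, s.sum = p ∧ ∀ q ∈ s, q < p ∧ (q = 4 ∨ tableEntry q N = .bullet)

end PeriodicComplementary

open PeriodicComplementary

namespace PeriodicComplementary

/-! ### Periodic autocorrelation of binary sequences -/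

/-! Existence rests on three constructions: families of equal length can be united
(`ExistsPCS.add`), an even number of sequences can be doubled in length (`ExistsPCS.double_length`),
and an SDS with `4 ∑ k = p N + 4 l` gives a family (`ExistsSDS.existsPCS`). Explicit SDS, verified
by computation, supply the rest; for `p = 4` only odd lengths need them.

Two necessary conditions rule out nearly all blank entries. Modulo 4 every autocorrelation value is
`N`, so `4 ∣ p * N` for `N > 1`, which forces even `N` when `4 ∤ p`. Summing over all shifts writes
`p * N` as a sum of `p` squares. What remains is `(1, 16)`, `(1, 36)`, `(2, 18)` and `(2, 36)`; the
second and third would each yield a pair of length 36.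

For `(2, 36)`, evaluate both sequences at `±ζ`, with `ζ` a primitive ninth root of unity. The two
norms add up to `72 = 9 * 8`. Since `-1` is not a square modulo 3 and the prime `1 - ζ` over 3 is
stable under conjugation, both values are divisible by 3. For entries `±1` this forces `a j + a (j +
18)` to have period 6, so its autocorrelation at shift 6 equals that at 0; but summed over the pair
the former is 0 and the latter is not. For `(1, 16)`, a sequence would give a negacyclic one of
length 8 over `{-1, 0, 1}`, excluded by enumeration. -/

theorem sum_pacf {N : ℕ} (a : Fin N → ℤ) : ∑ i, pacf a i = (∑ j, a j) ^ 2 := by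
  cases N with
  | zero => simp
  | succ n =>
    simp only [pacf]
    rw [Finset.sum_comm, sq, Finset.sum_mul]
    refine Finset.sum_congr rfl fun j _ => ?_
    rw [← Finset.mul_sum]
    congr 1
    exact Equiv.sum_comp (Equiv.addRight j) a

theorem pacf_zero {n : ℕ} (a : Fin (n + 1) → ℤ) : pacf a 0 = ∑ j, a j ^ 2 := by
  simp [pacf, sq]

theorem IsBinary.sq_eq_one {N : ℕ} {a : Fin N → ℤ} (ha : IsBinary a) (j : Fin N) :
    a j ^ 2 = 1 := by
  rcases ha j with h | h <;> simp [h]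

theorem IsPCS.sum_sq_sum_eq {p n : ℕ} {a : Fin p → Fin (n + 1) → ℤ} (ha : IsPCS a) :
    ∑ r, (∑ j, a r j) ^ 2 = p * (n + 1 : ℕ) := by
  simp only [← sum_pacf]
  rw [Finset.sum_comm, Finset.sum_eq_single 0]
  · simp [pacf_zero, (ha.1 _).sq_eq_one]
  · intro i _ hi
    exact ha.2 i fun h => hi (Fin.ext h)
  · simp

/-- For signs `x`, `y`, the product `(x - 1) * (y - 1)` is a multiple of 4, so `x * y ≡ x + y - 1`.
Summation gives `2 * S - N`, where `S`, the sum of the sequence, has the parity of `N`. -/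
theorem IsBinary.pacf_modEq {N : ℕ} {a : Fin N → ℤ} (ha : IsBinary a) (i : Fin N) :
    pacf a i ≡ N [ZMOD 4] := by
  have hN : NeZero N := ⟨by rintro rfl; exact i.elim0⟩
  have hterm : ∀ j, (4 : ℤ) ∣ a j * a (i + j) - (a j + a (i + j) - 1) := fun j => by
    rcases ha j with h | h <;> rcases ha (i + j) with h' | h' <;> rw [h, h'] <;> norm_num
  have hpar : ∀ j, (2 : ℤ) ∣ a j - 1 := fun j => by
    rcases ha j with h | h <;> rw [h] <;> norm_num
  have h1 := Finset.dvd_sum fun j (_ : j ∈ Finset.univ) => hterm j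
  have h2 := Finset.dvd_sum fun j (_ : j ∈ Finset.univ) => hpar j
  have h3 : ∑ j, a (i + j) = ∑ j, a j := Equiv.sum_comp (Equiv.addLeft i) a
  simp only [Finset.sum_sub_distrib, Finset.sum_add_distrib, h3] at h1 h2
  simp only [Finset.sum_const, Finset.card_univ, Fintype.card_fin, nsmul_eq_mul, mul_one] at h1 h2
  rw [Int.modEq_iff_dvd]
  change _ ∣ _ - ∑ j, a j * a (i + j)
  omega

theorem ExistsPCS.four_dvd_mul {p N : ℕ} (hN : 1 < N) (h : ExistsPCS p N) : 4 ∣ p * N := by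
  obtain ⟨a, ha, hac⟩ := h
  have h1 := hac ⟨1, hN⟩ (by simp)
  have h2 : ∑ r, pacf (a r) ⟨1, hN⟩ ≡ ∑ _r : Fin p, (N : ℤ) [ZMOD 4] :=
    Int.ModEq.sum fun r _ => (ha r).pacf_modEq _
  rw [h1, Finset.sum_const, Finset.card_univ, Fintype.card_fin, nsmul_eq_mul] at h2
  exact_mod_cast (Int.modEq_zero_iff_dvd.1 h2.symm)

/-! ### Combining families -/

theorem ExistsPCS.add {p q N : ℕ} (hp : ExistsPCS p N) (hq : ExistsPCS q N) :
    ExistsPCS (p + q) N := by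
  obtain ⟨a, ha, ha'⟩ := hp
  obtain ⟨b, hb, hb'⟩ := hq
  refine ⟨Fin.append a b, fun r => ?_, fun i hi => ?_⟩
  · refine Fin.addCases (fun r => ?_) (fun r => ?_) r
    · simpa using ha r
    · simpa using hb r
  · simp [Fin.sum_univ_add, ha' i hi, hb' i hi]

theorem existsPCS_zero (N : ℕ) : ExistsPCS 0 N :=
  ⟨fun _ _ => 1, fun r => r.elim0, by simp⟩

theorem existsPCS_one_right (p : ℕ) : ExistsPCS p 1 :=
  ⟨fun _ _ => 1, fun _ _ => Or.inl rfl, fun i hi => (hi (by omega)).elim⟩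

theorem ExistsPCS.mul_left {p N : ℕ} (h : ExistsPCS p N) (k : ℕ) : ExistsPCS (k * p) N := by
  induction k with
  | zero => simpa using existsPCS_zero N
  | succ k ih => rw [Nat.succ_mul]; exact ih.add h

theorem existsPCS_multiset_sum {N : ℕ} (s : Multiset ℕ) (h : ∀ q ∈ s, ExistsPCS q N) :
    ExistsPCS s.sum N := by
  induction s using Multiset.induction with
  | empty => simpa using existsPCS_zero N
  | cons q s ih =>
    rw [Multiset.sum_cons]
    exact (h q (by simp)).add (ih fun r hr => h r (by simp [hr]))

/-! ### Doubling the length -/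

/-- The sequence with the terms of `a` at the even places and those of `b` at the odd places. -/
def interleave {N : ℕ} (a b : Fin N → ℤ) (n : Fin (N * 2)) : ℤ :=
  if (n : ℕ) % 2 = 0 then a n.divNat else b n.divNat

theorem IsBinary.interleave {N : ℕ} {a b : Fin N → ℤ} (ha : IsBinary a) (hb : IsBinary b) :
    IsBinary (interleave a b) := fun n => by
  unfold PeriodicComplementary.interleave
  split_ifs
  exacts [ha _, hb _]

theorem IsBinary.neg {N : ℕ} {a : Fin N → ℤ} (ha : IsBinary a) : IsBinary (-a) := fun n => by
  rcases ha n with h | h <;> simp [h]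

theorem val_add_mod_two {N : ℕ} (i j : Fin (N * 2)) :
    ((i + j : Fin (N * 2)) : ℕ) % 2 = (i + j : ℕ) % 2 := by
  rw [Fin.val_add, Nat.mod_mod_of_dvd _ (Dvd.intro_left N rfl)]

/-- An odd shift pairs each term of `a` with a term of `b`, so negating `b` flips every product. -/
theorem pacf_interleave_odd {N : ℕ} (a b : Fin N → ℤ) {i : Fin (N * 2)} (hi : (i : ℕ) % 2 = 1) :
    pacf (interleave a b) i + pacf (interleave a (-b)) i = 0 := by
  simp only [pacf, ← Finset.sum_add_distrib]
  refine Finset.sum_eq_zero fun j _ => ?_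
  have h := val_add_mod_two i j
  rcases Nat.mod_two_eq_zero_or_one j with hj | hj
  · have h' : ((i + j : Fin (N * 2)) : ℕ) % 2 = 1 := by omega
    simp [interleave, hj, h']
  · have h' : ((i + j : Fin (N * 2)) : ℕ) % 2 = 0 := by omega
    simp [interleave, hj, h']

theorem divNat_add_of_even {N : ℕ} {i : Fin (N * 2)} (hi : (i : ℕ) % 2 = 0) (j : Fin (N * 2)) :
    (i + j).divNat = i.divNat + j.divNat := by
  ext
  simp only [Fin.coe_divNat, Fin.val_add]
  have h := Nat.mod_mul_right_div_self (i + j : ℕ) 2 N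
  rw [Nat.mul_comm 2 N] at h
  rw [h]
  congr 1
  omega

theorem pacf_interleave_even {N : ℕ} (a b : Fin N → ℤ) {i : Fin (N * 2)} (hi : (i : ℕ) % 2 = 0) :
    pacf (interleave a b) i = pacf a i.divNat + pacf b i.divNat := by
  have key : ∀ j : Fin (N * 2), interleave a b j * interleave a b (i + j) =
      if (j : ℕ) % 2 = 0 then a j.divNat * a (i.divNat + j.divNat)
      else b j.divNat * b (i.divNat + j.divNat) := fun j => by
    have h := val_add_mod_two i j
    rcases Nat.mod_two_eq_zero_or_one j with hj | hj
    · have h' : ((i + j : Fin (N * 2)) : ℕ) % 2 = 0 := by omega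
      simp [interleave, hj, h', divNat_add_of_even hi]
    · have h' : ((i + j : Fin (N * 2)) : ℕ) % 2 = 1 := by omega
      simp [interleave, hj, h', divNat_add_of_even hi]
  have hdiv : ∀ (q : Fin N) (e : Fin 2), (finProdFinEquiv (q, e)).divNat = q := fun q e =>
    congrArg Prod.fst (finProdFinEquiv.symm_apply_apply (q, e))
  rw [pacf, Finset.sum_congr rfl fun j _ => key j, ← Equiv.sum_comp finProdFinEquiv,
    Fintype.sum_prod_type]
  simp only [Fin.sum_univ_two, hdiv, Finset.sum_add_distrib, pacf]
  simp [finProdFinEquiv, Nat.add_mod]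

/-- The family is split into pairs `a, b`, each replaced by the interleavings of `a, b` and of `a,
-b`. Odd shifts cancel within a pair; even shifts reduce to twice the original sums. -/
theorem ExistsPCS.double_length {k N : ℕ} (h : ExistsPCS (k * 2) N) :
    ExistsPCS (k * 2) (N * 2) := by
  obtain ⟨a, ha, hac⟩ := h
  let b : Fin k × Fin 2 → Fin N → ℤ := fun x => a (finProdFinEquiv x)
  let c : Fin k × Fin 2 → Fin (N * 2) → ℤ := fun x =>
    if x.2 = 0 then interleave (b (x.1, 0)) (b (x.1, 1))
    else interleave (b (x.1, 0)) (-b (x.1, 1))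
  refine ⟨fun r => c (finProdFinEquiv.symm r), fun r => ?_, fun i hi => ?_⟩
  · simp only [c]
    split_ifs
    exacts [(ha _).interleave (ha _), (ha _).interleave (ha _).neg]
  · rw [← Equiv.sum_comp finProdFinEquiv, Fintype.sum_prod_type]
    simp only [Equiv.symm_apply_apply, Fin.sum_univ_two, c]
    simp only [if_true, Fin.one_eq_zero_iff, OfNat.ofNat_ne_one, if_false]
    rcases Nat.mod_two_eq_zero_or_one i with h2 | h2
    · have h0 : (i.divNat : ℕ) ≠ 0 := by
        rw [Fin.coe_divNat]
        omega
      have h1 := hac i.divNat h0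
      rw [← Equiv.sum_comp finProdFinEquiv, Fintype.sum_prod_type] at h1
      simp only [Fin.sum_univ_two] at h1
      have hneg : ∀ x, pacf (-b x) i.divNat = pacf (b x) i.divNat := fun x => by simp [pacf]
      simp only [pacf_interleave_even _ _ h2, hneg]
      simp only [b]
      rw [Finset.sum_add_distrib, h1, add_zero]
    · exact Finset.sum_eq_zero fun x _ => pacf_interleave_odd _ _ h2

/-! ### Supplementary difference sets -/

theorem nu_eq_sum {N : ℕ} (X : Finset (Fin N)) (m : Fin N) :
    (nu X m : ℤ) = ∑ j, (if j ∈ X then 1 else 0) * (if m + j ∈ X then 1 else 0) := by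
  have hN : NeZero N := ⟨by rintro rfl; exact m.elim0⟩
  simp only [← ite_and, mul_ite, mul_one, mul_zero, Finset.sum_boole, Nat.cast_inj]
  refine Finset.card_bij' (fun ij _ => ij.2) (fun j _ => (m + j, j)) ?_ ?_ ?_ ?_
  · rintro ⟨i, j⟩ h
    simp only [Finset.mem_filter, Finset.mem_product, sub_eq_iff_eq_add] at h
    simp [← h.2, h.1]
  · intro j h
    simp only [Finset.mem_filter, Finset.mem_univ, true_and] at h
    simp [h]
  · rintro ⟨i, j⟩ h
    simp only [Finset.mem_filter, Finset.mem_product, sub_eq_iff_eq_add] at h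
    simp [← h.2]
  · simp

/-- The sequence equal to `-1` exactly on `X` has autocorrelation `N - 4 * |X| + 4 * nu X i` at
shift `i`. -/
theorem ExistsSDS.existsPCS {p N l : ℕ} {k : Fin p → ℕ} (h : ExistsSDS N k l)
    (hl : 4 * ∑ r, k r = p * N + 4 * l) : ExistsPCS p N := by
  obtain ⟨X, hk, hX⟩ := h
  refine ⟨fun r j => 1 - 2 * (if j ∈ X r then 1 else 0), fun r j => ?_, fun i hi => ?_⟩
  · by_cases hj : j ∈ X r <;> simp [hj]
  · have hN : NeZero N := ⟨by rintro rfl; exact i.elim0⟩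
    have key : ∀ r, pacf (fun j => (1 : ℤ) - 2 * (if j ∈ X r then 1 else 0)) i =
        N - 4 * (X r).card + 4 * nu (X r) i := fun r => by
      have h1 : ∑ j, (if j ∈ X r then (1 : ℤ) else 0) = (X r).card := by simp
      have h2 : ∑ j, (if i + j ∈ X r then (1 : ℤ) else 0) = (X r).card := by
        rw [← h1]
        exact Equiv.sum_comp (Equiv.addLeft i) fun j => if j ∈ X r then (1 : ℤ) else 0
      have h3 : ∀ x y : ℤ, (1 - 2 * x) * (1 - 2 * y) = 1 - 2 * x - 2 * y + 4 * (x * y) :=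
        fun x y => by ring
      simp only [pacf, h3, Finset.sum_add_distrib, Finset.sum_sub_distrib, ← Finset.mul_sum, h1,
        h2, ← nu_eq_sum]
      simp
      ring
    have hs := hX i hi
    simp only [key, hk, Finset.sum_add_distrib, Finset.sum_sub_distrib, ← Finset.mul_sum]
    zify at hs hl
    simp only [Finset.sum_const, Finset.card_univ, Fintype.card_fin, nsmul_eq_mul]
    linarith

/-! ### Sets given by binary digits -/

/-- The set of the positions below `N` of the binary digits `1` of `x`. -/
def digitSet (N x : ℕ) : Finset (Fin N) :=
  Finset.univ.filter fun j => x.testBit j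

/-- The number of digits `1` of `x` below position `N`. -/
def digitCount (N x : ℕ) : ℕ :=
  (List.range N).countP fun j => x.testBit j

/-- The number of `j < N` such that both `j` and `m + j` modulo `N` are positions of a digit `1`
of `x`. -/
def digitCorrelation (N x m : ℕ) : ℕ :=
  (List.range N).countP fun j => x.testBit j && x.testBit ((m + j) % N)

theorem card_filter_fin_eq_countP (N : ℕ) (q : ℕ → Bool) :
    (Finset.univ.filter fun j : Fin N => q j).card = (List.range N).countP q := by
  rw [← List.map_coe_finRange_eq_range, List.countP_map, List.countP_eq_length_filter]
  simp only [Finset.card, Finset.filter, Fin.univ_def, Multiset.filter_coe, Multiset.coe_card]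
  simp [Function.comp_def]

theorem card_digitSet (N x : ℕ) : (digitSet N x).card = digitCount N x :=
  card_filter_fin_eq_countP N _

theorem nu_digitSet {N : ℕ} (x : ℕ) (m : Fin N) :
    nu (digitSet N x) m = digitCorrelation N x m := by
  have h := nu_eq_sum (digitSet N x) m
  simp only [mul_ite, mul_one, mul_zero, ← ite_and, Finset.sum_boole, Nat.cast_inj] at h
  rw [h, digitCorrelation, ← card_filter_fin_eq_countP]
  congr 1
  ext j
  simp [digitSet, Fin.val_add, and_comm]

theorem existsSDS_of_digits {p N : ℕ} (x : Fin p → ℕ) {k : Fin p → ℕ} {l : ℕ}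
    (h : (∀ r, digitCount N (x r) = k r) ∧
      ∀ m < N, m ≠ 0 → ∑ r, digitCorrelation N (x r) m = l) : ExistsSDS N k l :=
  ⟨fun r => digitSet N (x r), fun r => by rw [card_digitSet, h.1], fun m hm => by
    simp only [nu_digitSet, h.2 m m.2 hm]⟩

/-! ### Divisibility by 3 in the ring generated by a primitive ninth root of unity -/

section NinthRoot

open Polynomial ComplexConjugate

variable {ζ : ℂ}

theorem ninthRoot_relation (hζ : IsPrimitiveRoot ζ 9) : ζ ^ 6 + ζ ^ 3 + 1 = 0 := by
  have h1 : ζ ^ 9 = 1 := hζ.pow_eq_one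
  have h3 : ζ ^ 3 - 1 ≠ 0 := sub_ne_zero.2 (hζ.pow_ne_one_of_pos_of_lt (by norm_num) (by norm_num))
  refine (mul_eq_zero.1 ?_).resolve_left h3
  linear_combination h1

theorem conj_ninthRoot (hζ : IsPrimitiveRoot ζ 9) : conj ζ = ζ ^ 8 := by
  rw [← Complex.inv_eq_conj (hζ.norm'_eq_one (by norm_num))]
  refine inv_eq_of_mul_eq_one_right ?_
  rw [← pow_succ']
  exact hζ.pow_eq_one

theorem self_mem_adjoin : ζ ∈ Algebra.adjoin ℤ {ζ} :=
  Algebra.self_mem_adjoin_singleton ℤ ζ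

theorem conj_mem_adjoin (hζ : IsPrimitiveRoot ζ 9) {x : ℂ} (hx : x ∈ Algebra.adjoin ℤ {ζ}) :
    conj x ∈ Algebra.adjoin ℤ {ζ} := by
  induction hx using Algebra.adjoin_induction with
  | mem x hx =>
    rw [Set.mem_singleton_iff.1 hx, conj_ninthRoot hζ]
    exact pow_mem self_mem_adjoin 8
  | algebraMap r => simp
  | add x y _ _ hx hy => rw [map_add]; exact add_mem hx hy
  | mul x y _ _ hx hy => rw [map_mul]; exact mul_mem hx hy

theorem exists_int_add_mul_of_mem_adjoin {x : ℂ} (hx : x ∈ Algebra.adjoin ℤ {ζ}) :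
    ∃ m : ℤ, ∃ y ∈ Algebra.adjoin ℤ {ζ}, x = m + (1 - ζ) * y := by
  induction hx using Algebra.adjoin_induction with
  | mem x hx =>
    rw [Set.mem_singleton_iff.1 hx]
    exact ⟨1, -1, neg_mem (one_mem _), by push_cast; ring⟩
  | algebraMap r => exact ⟨r, 0, zero_mem _, by simp⟩
  | add x y _ _ hx hy =>
    obtain ⟨m, u, hu, rfl⟩ := hx
    obtain ⟨n, v, hv, rfl⟩ := hy
    exact ⟨m + n, u + v, add_mem hu hv, by push_cast; ring⟩
  | mul x y _ hy' hx hy =>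
    obtain ⟨m, u, hu, rfl⟩ := hx
    obtain ⟨n, v, hv, h⟩ := hy
    refine ⟨m * n, m * v + u * y, add_mem (mul_mem (intCast_mem _ _) hv) (mul_mem hu hy'), ?_⟩
    push_cast
    linear_combination (m : ℂ) * h

/-- The powers `1, ζ, …, ζ⁵` are linearly independent modulo `3`. -/
theorem three_dvd_coeff (hζ : IsPrimitiveRoot ζ 9) {P : ℤ[X]} (hP : P.degree < 6) {y : ℂ}
    (hy : y ∈ Algebra.adjoin ℤ {ζ}) (h : aeval ζ P = 3 * y) (n : ℕ) : 3 ∣ P.coeff n := by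
  rw [Algebra.adjoin_singleton_eq_range_aeval] at hy
  obtain ⟨Q, rfl⟩ := hy
  have hmonic := cyclotomic.monic 9 ℤ
  have hdeg : (cyclotomic 9 ℤ).degree = 6 := by
    rw [degree_cyclotomic]
    rfl
  have hroot : aeval ζ (cyclotomic 9 ℤ) = 0 := by
    rw [cyclotomic_eq_minpoly hζ (by norm_num)]
    exact minpoly.aeval _ _
  -- This polynomial vanishes at `ζ` and has degree below that of the minimal polynomial.
  have hzero : P - C 3 * (Q %ₘ cyclotomic 9 ℤ) = 0 := by
    refine eq_zero_of_dvd_of_degree_lt (p := cyclotomic 9 ℤ) ?_ ?_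
    · nth_rewrite 1 [cyclotomic_eq_minpoly hζ (by norm_num)]
      refine minpoly.isIntegrallyClosed_dvd (hζ.isIntegral (by norm_num)) ?_
      have hQ := congrArg (aeval ζ) (modByMonic_add_div Q (cyclotomic 9 ℤ))
      rw [map_add, map_mul, hroot, zero_mul, add_zero] at hQ
      simp only [map_sub, map_mul, h, hQ, aeval_C]
      simp
    · rw [hdeg]
      refine (degree_sub_le _ _).trans_lt (max_lt hP ?_)
      rw [degree_C_mul (by norm_num), ← hdeg]
      exact degree_modByMonic_lt _ hmonic
  rw [sub_eq_zero.1 hzero, coeff_C_mul]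
  exact dvd_mul_right _ _

theorem exists_one_sub_pow_six_eq (hζ : IsPrimitiveRoot ζ 9) :
    ∃ w ∈ Algebra.adjoin ℤ {ζ}, (1 - ζ) ^ 6 = 3 * w := by
  -- The binomial expansion minus `ζ ^ 6 + ζ ^ 3 + 1`, divided by 3.
  refine ⟨_, aeval_mem_adjoin_singleton ℤ ζ
    (p := -2 * X + 5 * X ^ 2 - 7 * X ^ 3 + 5 * X ^ 4 - 2 * X ^ 5), ?_⟩
  simp only [map_add, map_sub, map_mul, map_neg, map_ofNat, map_pow, aeval_X]
  linear_combination ninthRoot_relation hζ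

theorem exists_three_eq_one_sub_pow_six_mul (hζ : IsPrimitiveRoot ζ 9) :
    ∃ v ∈ Algebra.adjoin ℤ {ζ}, 3 = (1 - ζ) ^ 6 * v := by
  -- The inverse of the unit `(1 - ζ) ^ 6 / 3`.
  refine ⟨_, aeval_mem_adjoin_singleton ℤ ζ
    (p := 10 + 11 * X + 7 * X ^ 2 + 10 * X ^ 3 + 4 * X ^ 4 - 4 * X ^ 5), ?_⟩
  simp only [map_add, map_sub, map_mul, map_ofNat, map_pow, aeval_X]
  linear_combination (-7 + 49 * ζ - 91 * ζ ^ 2 + 74 * ζ ^ 3 - 28 * ζ ^ 4 + 4 * ζ ^ 5) *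
    ninthRoot_relation hζ

/-- The sixth power of `m` is a multiple of 3 in the ring, hence in `ℤ`. -/
theorem three_dvd_of_eq_one_sub_mul (hζ : IsPrimitiveRoot ζ 9) {m : ℤ} {y : ℂ}
    (hy : y ∈ Algebra.adjoin ℤ {ζ}) (h : (m : ℂ) = (1 - ζ) * y) : 3 ∣ m := by
  obtain ⟨w, hw, hw'⟩ := exists_one_sub_pow_six_eq hζ
  have hm : (m : ℂ) ^ 6 = 3 * (w * y ^ 6) := by
    rw [h, mul_pow, hw', mul_assoc]
  have h3 := three_dvd_coeff hζ (P := C (m ^ 6)) (degree_C_le.trans_lt (by norm_num))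
    (mul_mem hw (pow_mem hy 6)) (by simpa using hm) 0
  rw [coeff_C_zero] at h3
  exact Int.prime_three.dvd_of_dvd_pow h3

/-- The prime `1 - ζ` over `3` divides both terms of a sum of two norms that it divides, because
`-1` is not a square modulo `3`. -/
theorem one_sub_dvd_of_dvd_norm_add_norm (hζ : IsPrimitiveRoot ζ 9) {α β t : ℂ}
    (hα : α ∈ Algebra.adjoin ℤ {ζ}) (hβ : β ∈ Algebra.adjoin ℤ {ζ})
    (ht : t ∈ Algebra.adjoin ℤ {ζ}) (h : α * conj α + β * conj β = (1 - ζ) * t) :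
    (∃ x ∈ Algebra.adjoin ℤ {ζ}, α = (1 - ζ) * x) ∧
      ∃ x ∈ Algebra.adjoin ℤ {ζ}, β = (1 - ζ) * x := by
  have hs := self_mem_adjoin (ζ := ζ)
  obtain ⟨v, hv, hv'⟩ := exists_three_eq_one_sub_pow_six_mul hζ
  have hv6 : (1 - ζ) ^ 5 * v ∈ Algebra.adjoin ℤ {ζ} :=
    mul_mem (pow_mem (sub_mem (one_mem _) hs) 5) hv
  obtain ⟨m, x, hx, rfl⟩ := exists_int_add_mul_of_mem_adjoin hα
  obtain ⟨n, y, hy, rfl⟩ := exists_int_add_mul_of_mem_adjoin hβ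
  have hconj : conj (1 - ζ) = (1 - ζ) * (∑ i ∈ Finset.range 8, ζ ^ i) := by
    rw [map_sub, map_one, conj_ninthRoot hζ, mul_neg_geom_sum]
  have hgeom : ∑ i ∈ Finset.range 8, ζ ^ i ∈ Algebra.adjoin ℤ {ζ} :=
    sum_mem fun i _ => pow_mem hs i
  generalize ∑ i ∈ Finset.range 8, ζ ^ i = g at hconj hgeom
  simp only [map_add, map_mul, hconj, map_intCast] at h
  have hcast : ∀ k : ℤ, (k : ℂ) ∈ Algebra.adjoin ℤ {ζ} := fun k => intCast_mem _ k
  have hcx := conj_mem_adjoin hζ hx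
  have hcy := conj_mem_adjoin hζ hy
  have hone : 1 - ζ ∈ Algebra.adjoin ℤ {ζ} := sub_mem (one_mem _) hs
  -- Modulo `1 - ζ`, both `α` and its conjugate are `m`, and both `β` and its conjugate are `n`.
  have hmod : 3 ∣ m ^ 2 + n ^ 2 := by
    refine three_dvd_of_eq_one_sub_mul hζ
      (y := t - (m * (g * conj x) + x * (m + (1 - ζ) * g * conj x)) -
        (n * (g * conj y) + y * (n + (1 - ζ) * g * conj y))) ?_ ?_
    · refine sub_mem (sub_mem ht ?_) ?_
      · exact add_mem (mul_mem (hcast m) (mul_mem hgeom hcx))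
          (mul_mem hx (add_mem (hcast m) (mul_mem (mul_mem hone hgeom) hcx)))
      · exact add_mem (mul_mem (hcast n) (mul_mem hgeom hcy))
          (mul_mem hy (add_mem (hcast n) (mul_mem (mul_mem hone hgeom) hcy)))
    · push_cast
      linear_combination h
  have hzmod : ∀ x y : ZMod 3, x ^ 2 + y ^ 2 = 0 → x = 0 ∧ y = 0 := by decide
  have hmn := hzmod m n (by
    have := (ZMod.intCast_zmod_eq_zero_iff_dvd (m ^ 2 + n ^ 2) 3).2 hmod
    exact_mod_cast this)
  rw [ZMod.intCast_zmod_eq_zero_iff_dvd, ZMod.intCast_zmod_eq_zero_iff_dvd] at hmn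
  obtain ⟨⟨m', rfl⟩, ⟨n', rfl⟩⟩ := hmn
  refine ⟨⟨(1 - ζ) ^ 5 * v * m' + x, add_mem (mul_mem hv6 (hcast m')) hx, ?_⟩,
    ⟨(1 - ζ) ^ 5 * v * n' + y, add_mem (mul_mem hv6 (hcast n')) hy, ?_⟩⟩
  · push_cast
    linear_combination (m' : ℂ) * hv'
  · push_cast
    linear_combination (n' : ℂ) * hv'

/-- Descent: dividing both terms by `1 - ζ` removes one factor `(1 - ζ) * conj (1 - ζ)` from the sum
of norms. -/
theorem one_sub_pow_dvd_of_dvd_norm_add_norm (hζ : IsPrimitiveRoot ζ 9) (n : ℕ) {α β t : ℂ}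
    (hα : α ∈ Algebra.adjoin ℤ {ζ}) (hβ : β ∈ Algebra.adjoin ℤ {ζ})
    (ht : t ∈ Algebra.adjoin ℤ {ζ})
    (h : α * conj α + β * conj β = ((1 - ζ) * conj (1 - ζ)) ^ n * t) :
    (∃ x ∈ Algebra.adjoin ℤ {ζ}, α = (1 - ζ) ^ n * x) ∧
      ∃ x ∈ Algebra.adjoin ℤ {ζ}, β = (1 - ζ) ^ n * x := by
  induction n generalizing α β with
  | zero => exact ⟨⟨α, hα, by simp⟩, ⟨β, hβ, by simp⟩⟩
  | succ n ih =>
    have hone : 1 - ζ ∈ Algebra.adjoin ℤ {ζ} := sub_mem (one_mem _) self_mem_adjoin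
    have hcone := conj_mem_adjoin hζ hone
    obtain ⟨⟨x, hx, rfl⟩, ⟨y, hy, rfl⟩⟩ := one_sub_dvd_of_dvd_norm_add_norm hζ hα hβ
      (t := conj (1 - ζ) * (((1 - ζ) * conj (1 - ζ)) ^ n * t))
      (mul_mem hcone (mul_mem (pow_mem (mul_mem hone hcone) n) ht)) (by rw [h]; ring)
    have hne : 1 - ζ ≠ 0 := sub_ne_zero.2 (hζ.ne_one (by norm_num)).symm
    have hne' : (1 - ζ) * conj (1 - ζ) ≠ 0 := mul_ne_zero hne ((_root_.map_ne_zero _).2 hne)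
    have hxy : x * conj x + y * conj y = ((1 - ζ) * conj (1 - ζ)) ^ n * t := by
      refine mul_left_cancel₀ hne' ?_
      rw [map_mul, map_mul] at h
      linear_combination h
    obtain ⟨⟨x', hx', rfl⟩, ⟨y', hy', rfl⟩⟩ := ih hx hy hxy
    exact ⟨⟨x', hx', by ring⟩, ⟨y', hy', by ring⟩⟩

theorem three_dvd_of_norm_add_norm_eq (hζ : IsPrimitiveRoot ζ 9) {α β : ℂ} (c : ℤ)
    (hα : α ∈ Algebra.adjoin ℤ {ζ}) (hβ : β ∈ Algebra.adjoin ℤ {ζ})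
    (h : α * conj α + β * conj β = 9 * c) :
    (∃ x ∈ Algebra.adjoin ℤ {ζ}, α = 3 * x) ∧ ∃ x ∈ Algebra.adjoin ℤ {ζ}, β = 3 * x := by
  obtain ⟨v, hv, hv'⟩ := exists_three_eq_one_sub_pow_six_mul hζ
  obtain ⟨w, hw, hw'⟩ := exists_one_sub_pow_six_eq hζ
  have hv'' : 3 = conj (1 - ζ) ^ 6 * conj v := by
    have h3 := congrArg conj hv'
    rwa [map_ofNat, map_mul, map_pow] at h3
  obtain ⟨⟨x, hx, rfl⟩, ⟨y, hy, rfl⟩⟩ := one_sub_pow_dvd_of_dvd_norm_add_norm hζ 6 hα hβ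
    (t := v * conj v * c) (mul_mem (mul_mem hv (conj_mem_adjoin hζ hv)) (intCast_mem _ c)) (by
      rw [h]
      linear_combination (3 * (c : ℂ)) * hv' + (c : ℂ) * ((1 - ζ) ^ 6 * v) * hv'')
  exact ⟨⟨w * x, mul_mem hw hx, by rw [hw', mul_assoc]⟩,
    ⟨w * y, mul_mem hw hy, by rw [hw', mul_assoc]⟩⟩

/-- A multiple of `3` in `ℤ[ζ]` has coefficients that are constant modulo `3` on the cosets of the
subgroup of order three of `ℤ/9`. -/
theorem three_dvd_sub_of_sum_eq (hζ : IsPrimitiveRoot ζ 9) (A : Fin 9 → ℤ) {y : ℂ}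
    (hy : y ∈ Algebra.adjoin ℤ {ζ}) (h : ∑ k, (A k : ℂ) * ζ ^ (k : ℕ) = 3 * y) (k : Fin 9) :
    3 ∣ A k - A (k + 3) := by
  -- Degrees 6, 7 and 8 are eliminated by `ζ ^ 6 = -1 - ζ ^ 3`.
  let P : ℤ[X] := C (A 0 - A 6) + C (A 1 - A 7) * X + C (A 2 - A 8) * X ^ 2 +
    C (A 3 - A 6) * X ^ 3 + C (A 4 - A 7) * X ^ 4 + C (A 5 - A 8) * X ^ 5
  have hP : P.degree < 6 := by
    have : P.degree ≤ 5 := by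
      simp only [P]
      compute_degree
    exact this.trans_lt (by norm_num)
  have hPζ : aeval ζ P = 3 * y := by
    rw [← h]
    simp only [P, Fin.sum_univ_succ, map_add, map_mul, map_pow, aeval_X, aeval_C]
    simp
    linear_combination (-(A 6 : ℂ) - A 7 * ζ - A 8 * ζ ^ 2) * ninthRoot_relation hζ
  have hc := three_dvd_coeff hζ hP hy hPζ
  have hcoeff : ∀ n, P.coeff n = (if n = 0 then A 0 - A 6 else 0) +
      (A 1 - A 7) * (if 1 = n then 1 else 0) + (A 2 - A 8) * (if n = 2 then 1 else 0) +
      (A 3 - A 6) * (if n = 3 then 1 else 0) + (A 4 - A 7) * (if n = 4 then 1 else 0) +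
      (A 5 - A 8) * (if n = 5 then 1 else 0) := fun n => by
    simp only [P, coeff_add, coeff_C_mul, coeff_X_pow, coeff_C, coeff_X]
  have h0 := hcoeff 0 ▸ hc 0
  have h1 := hcoeff 1 ▸ hc 1
  have h2 := hcoeff 2 ▸ hc 2
  have h3 := hcoeff 3 ▸ hc 3
  have h4 := hcoeff 4 ▸ hc 4
  have h5 := hcoeff 5 ▸ hc 5
  norm_num at h0 h1 h2 h3 h4 h5
  fin_cases k <;> simp <;> omega

/-- The power spectrum is the Fourier transform of the autocorrelation. -/
theorem sum_mul_conj_sum {N : ℕ} [NeZero N] (a : Fin N → ℤ) {ξ : ℂ} (hN : ξ ^ N = 1)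
    (hξ : ξ * conj ξ = 1) :
    (∑ j, (a j : ℂ) * ξ ^ (j : ℕ)) * conj (∑ j, (a j : ℂ) * ξ ^ (j : ℕ)) =
      ∑ i, (pacf a i : ℂ) * ξ ^ (i : ℕ) := by
  simp only [pacf, Int.cast_sum, Int.cast_mul, Finset.sum_mul]
  conv_rhs => rw [Finset.sum_comm]
  rw [← Finset.sum_mul, map_sum, Finset.sum_mul_sum, Finset.sum_comm]
  refine Finset.sum_congr rfl fun j _ => ?_
  rw [← Equiv.sum_comp (Equiv.addRight j)]
  refine Finset.sum_congr rfl fun i _ => ?_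
  have h1 : ξ ^ ((i + j : Fin N) : ℕ) = ξ ^ (i : ℕ) * ξ ^ (j : ℕ) := by
    rw [Fin.val_add, ← pow_add, ← pow_eq_pow_mod _ hN]
  have h2 : ξ ^ (j : ℕ) * conj ξ ^ (j : ℕ) = 1 := by rw [← mul_pow, hξ, one_pow]
  simp only [Equiv.coe_addRight, h1, map_mul, map_pow, map_intCast]
  linear_combination (a j * a (i + j) * ξ ^ (i : ℕ) : ℂ) * h2

/-- The coefficient of `ζ ^ k` in the value at `ε * ζ`, where `ε ^ 2 = 1`, of the polynomial with
coefficients `a`. -/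
def twistedFold (ε : ℤ) (a : Fin 36 → ℤ) (k : Fin 9) : ℤ :=
  ∑ q : Fin 4, ε ^ (k + q : ℕ) * a ⟨k + 9 * q, by omega⟩

theorem sum_eq_sum_twistedFold (hζ : IsPrimitiveRoot ζ 9) {ε : ℤ} (hε : ε ^ 2 = 1)
    (a : Fin 36 → ℤ) :
    ∑ j, (a j : ℂ) * (ε * ζ) ^ (j : ℕ) = ∑ k, (twistedFold ε a k : ℂ) * ζ ^ (k : ℕ) := by
  have h9 : ζ ^ 9 = 1 := hζ.pow_eq_one
  have hε' : (ε : ℂ) ^ 2 = 1 := by exact_mod_cast hε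
  rw [← Equiv.sum_comp (finProdFinEquiv : Fin 4 × Fin 9 ≃ Fin 36), Fintype.sum_prod_type,
    Finset.sum_comm]
  refine Finset.sum_congr rfl fun k _ => ?_
  rw [twistedFold, Int.cast_sum, Finset.sum_mul]
  refine Finset.sum_congr rfl fun q _ => ?_
  change (a ⟨k + 9 * q, _⟩ : ℂ) * (ε * ζ) ^ (k + 9 * q : ℕ) = _
  have h1 : ζ ^ (k + 9 * q : ℕ) = ζ ^ (k : ℕ) := by rw [pow_add, pow_mul, h9, one_pow, mul_one]
  have h2 : (ε : ℂ) ^ (k + 9 * q : ℕ) = ε ^ (k + q : ℕ) := by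
    have : (k + 9 * q : ℕ) = k + q + 2 * (4 * q) := by ring
    rw [this, pow_add, pow_mul, hε', one_pow, mul_one]
  rw [mul_pow, h1, h2]
  push_cast
  ring

theorem IsPCS.three_dvd_twistedFold {a : Fin 2 → Fin 36 → ℤ} (ha : IsPCS a) {ε : ℤ}
    (hε : ε ^ 2 = 1) (r : Fin 2) (k : Fin 9) :
    3 ∣ twistedFold ε (a r) k - twistedFold ε (a r) (k + 3) := by
  obtain ⟨ζ, hζ⟩ : ∃ ζ : ℂ, IsPrimitiveRoot ζ 9 :=
    ⟨_, Complex.isPrimitiveRoot_exp 9 (by norm_num)⟩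
  have hε' : (ε : ℂ) ^ 2 = 1 := by exact_mod_cast hε
  have hN : (ε * ζ) ^ 36 = 1 := by
    have h9 : ζ ^ 9 = 1 := hζ.pow_eq_one
    calc (ε * ζ) ^ 36 = ((ε : ℂ) ^ 2) ^ 18 * (ζ ^ 9) ^ 4 := by ring
      _ = 1 := by rw [hε', h9, one_pow, one_pow, one_mul]
  have hξ : (ε * ζ) * conj (ε * ζ) = 1 := by
    have h9 : ζ ^ 9 = 1 := hζ.pow_eq_one
    rw [map_mul, conj_ninthRoot hζ, map_intCast]
    calc (ε * ζ) * (ε * ζ ^ 8) = (ε : ℂ) ^ 2 * ζ ^ 9 := by ring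
      _ = 1 := by rw [hε', h9, one_mul]
  have hmem : ∀ r, ∑ j, (a r j : ℂ) * (ε * ζ) ^ (j : ℕ) ∈ Algebra.adjoin ℤ {ζ} := fun r => by
    refine sum_mem fun j _ => mul_mem (intCast_mem _ _) (pow_mem (mul_mem (intCast_mem _ _) ?_) _)
    exact self_mem_adjoin
  have hsum := Finset.sum_congr rfl fun r (_ : r ∈ Finset.univ) => sum_mul_conj_sum (a r) hN hξ
  have htotal : ∑ r, ∑ i, (pacf (a r) i : ℂ) * (ε * ζ) ^ (i : ℕ) = 9 * (8 : ℤ) := by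
    rw [Finset.sum_comm, Finset.sum_eq_single 0]
    · simp [pacf_zero, (ha.1 _).sq_eq_one]
      norm_num
    · intro i _ hi
      rw [← Finset.sum_mul, ← Int.cast_sum, ha.2 i fun h => hi (Fin.ext h), Int.cast_zero,
        zero_mul]
    · simp
  rw [htotal, Fin.sum_univ_two] at hsum
  have h3 := three_dvd_of_norm_add_norm_eq hζ 8 (hmem 0) (hmem 1) hsum
  have hr : ∃ x ∈ Algebra.adjoin ℤ {ζ}, ∑ j, (a r j : ℂ) * (ε * ζ) ^ (j : ℕ) = 3 * x := by
    fin_cases r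
    exacts [h3.1, h3.2]
  obtain ⟨x, hx, hx'⟩ := hr
  rw [sum_eq_sum_twistedFold hζ hε] at hx'
  exact three_dvd_sub_of_sum_eq hζ _ hx hx' k

end NinthRoot

/-! ### No pair of length thirty-six -/

theorem add_eq_add_of_three_dvd {x y z w : ℤ} (hx : x = 1 ∨ x = -1) (hy : y = 1 ∨ y = -1)
    (hz : z = 1 ∨ z = -1) (hw : w = 1 ∨ w = -1) (h : 3 ∣ x + y - (z + w)) : x + y = z + w := by
  -- The difference is even and at most 4 in absolute value.
  omega

theorem add_eq_add_of_three_dvd_twistedFold {a : Fin 36 → ℤ} (ha : IsBinary a)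
    (h : ∀ ε : ℤ, ε ^ 2 = 1 → ∀ k, 3 ∣ twistedFold ε a k - twistedFold ε a (k + 3))
    (j : Fin 36) : a j + a (j + 18) = a (j + 6) + a (j + 24) := by
  have hp := h 1 (by norm_num)
  have hm := h (-1) (by norm_num)
  have key : ∀ k : Fin 9, (a ⟨k, by omega⟩ + a ⟨k + 18, by omega⟩ =
      a (⟨k, by omega⟩ + 12) + a (⟨k, by omega⟩ + 30)) ∧
      (a ⟨k + 9, by omega⟩ + a ⟨k + 27, by omega⟩ =
        a (⟨k, by omega⟩ + 3) + a (⟨k, by omega⟩ + 21)) := by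
    intro k
    have hpk := hp k
    have hmk := hm k
    simp only [twistedFold, Fin.sum_univ_four] at hpk hmk
    -- Adding and subtracting the congruences for `ε = 1` and `ε = -1` separates even `q` from odd
    -- `q`, as 2 is invertible modulo 3.
    refine ⟨add_eq_add_of_three_dvd (ha _) (ha _) (ha _) (ha _) ?_,
      add_eq_add_of_three_dvd (ha _) (ha _) (ha _) (ha _) ?_⟩ <;>
    fin_cases k <;> simp at hpk hmk ⊢ <;> omega
  have k0 := key 0
  have k1 := key 1
  have k2 := key 2
  have k3 := key 3
  have k4 := key 4
  have k5 := key 5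
  have k6 := key 6
  have k7 := key 7
  have k8 := key 8
  simp at k0 k1 k2 k3 k4 k5 k6 k7 k8
  clear key hp hm h ha
  fin_cases j <;> simp <;> omega

theorem sum_mul_shift {N : ℕ} [NeZero N] (a : Fin N → ℤ) (u v : Fin N) :
    ∑ j, a (j + u) * a (j + v) = pacf a (v - u) := by
  rw [pacf]
  conv_rhs => rw [← Equiv.sum_comp (Equiv.addRight u)]
  refine Finset.sum_congr rfl fun j _ => ?_
  rw [Equiv.coe_addRight]
  change _ = a (j + u) * a (v - u + (j + u))
  rw [add_comm j u, ← add_assoc, sub_add_cancel, add_comm j v]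

theorem not_existsPCS_two_thirtySix : ¬ ExistsPCS 2 36 := by
  rintro ⟨a, ha⟩
  have hper := fun r => add_eq_add_of_three_dvd_twistedFold (ha.1 r)
    fun ε hε k => ha.three_dvd_twistedFold hε r k
  have hzero : ∀ r, ∑ j, (a r (j + 0) + a r (j + 18)) * (a r (j + 6) + a r (j + 24)) =
      ∑ j, (a r (j + 0) + a r (j + 18)) * (a r (j + 0) + a r (j + 18)) := fun r => by
    refine Finset.sum_congr rfl fun j _ => ?_
    rw [← hper r j, add_zero]
  have hsum := Finset.sum_congr rfl fun r (_ : r ∈ Finset.univ) => hzero r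
  simp only [add_mul, mul_add, Finset.sum_add_distrib, sum_mul_shift] at hsum
  have h0 : ∀ i : Fin 36, i ≠ 0 → ∑ r, pacf (a r) i = 0 := fun i hi =>
    ha.2 i fun h => hi (Fin.ext h)
  -- Every shift on the left is nonzero, while on the right shift 0 occurs twice: `0 = 2 * 72`.
  rw [h0 (6 - 0) (by decide), h0 (6 - 18) (by decide), h0 (24 - 0) (by decide),
    h0 (24 - 18) (by decide), h0 (0 - 18) (by decide), h0 (18 - 0) (by decide), sub_self, sub_self]
    at hsum
  simp [pacf_zero, (ha.1 _).sq_eq_one] at hsum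

/-! ### Length sixteen -/

/-- Shifts 1, 2, 3 suffice: the negacyclic autocorrelation at 4 vanishes identically, and those at
5, 6, 7 are the negatives of those at 3, 2, 1. -/
theorem negacyclic_weight_four : ∀ x₀ ∈ [(-1 : ℤ), 0, 1], ∀ x₁ ∈ [(-1 : ℤ), 0, 1],
    ∀ x₂ ∈ [(-1 : ℤ), 0, 1], ∀ x₃ ∈ [(-1 : ℤ), 0, 1], ∀ x₄ ∈ [(-1 : ℤ), 0, 1],
    ∀ x₅ ∈ [(-1 : ℤ), 0, 1], ∀ x₆ ∈ [(-1 : ℤ), 0, 1], ∀ x₇ ∈ [(-1 : ℤ), 0, 1],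
    x₀ * x₀ + x₁ * x₁ + x₂ * x₂ + x₃ * x₃ + x₄ * x₄ + x₅ * x₅ + x₆ * x₆ + x₇ * x₇ = 4 →
    x₀ * x₁ + x₁ * x₂ + x₂ * x₃ + x₃ * x₄ + x₄ * x₅ + x₅ * x₆ + x₆ * x₇ = x₇ * x₀ →
    x₀ * x₂ + x₁ * x₃ + x₂ * x₄ + x₃ * x₅ + x₄ * x₆ + x₅ * x₇ = x₆ * x₀ + x₇ * x₁ →
    x₀ * x₃ + x₁ * x₄ + x₂ * x₅ + x₃ * x₆ + x₄ * x₇ ≠ x₅ * x₀ + x₆ * x₁ + x₇ * x₂ := by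
  decide +kernel

theorem not_existsPCS_one_sixteen : ¬ ExistsPCS 1 16 := by
  rintro ⟨a, ha⟩
  have hb := ha.1 0
  generalize hab : a 0 = b at hb
  have hc : ∀ i : Fin 16, i ≠ 0 → pacf b i = 0 := fun i hi => by
    have := ha.2 i fun h => hi (Fin.ext h)
    rwa [Fin.sum_univ_one, hab] at this
  -- The halved differences change sign under the shift by 8, so eight of them form a negacyclic
  -- sequence; shift 0 of `hcorr` gives it weight 4.
  have hhalf : ∀ j : Fin 16, ∃ x ∈ [(-1 : ℤ), 0, 1], b (j + 0) - b (j + 8) = 2 * x := fun j => by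
    rcases hb (j + 0) with h | h <;> rcases hb (j + 8) with h' | h' <;> rw [h, h'] <;> simp
  have hcorr : ∀ d : Fin 16, ∑ j, (b (j + 0) - b (j + 8)) * (b (j + d) - b (j + (d + 8))) =
      2 * (pacf b d - pacf b (d + 8)) := fun d => by
    simp only [sub_mul, mul_sub, Finset.sum_sub_distrib, sum_mul_shift]
    have h1 : d - 8 = d + 8 := by revert d; decide
    have h2 : d + 8 - 8 = d := by simp
    rw [sub_zero, sub_zero, h1, h2]
    ring
  obtain ⟨x₀, m₀, h₀⟩ := hhalf 0
  obtain ⟨x₁, m₁, h₁⟩ := hhalf 1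
  obtain ⟨x₂, m₂, h₂⟩ := hhalf 2
  obtain ⟨x₃, m₃, h₃⟩ := hhalf 3
  obtain ⟨x₄, m₄, h₄⟩ := hhalf 4
  obtain ⟨x₅, m₅, h₅⟩ := hhalf 5
  obtain ⟨x₆, m₆, h₆⟩ := hhalf 6
  obtain ⟨x₇, m₇, h₇⟩ := hhalf 7
  have c0 := hcorr 0
  have c1 := hcorr 1
  have c2 := hcorr 2
  have c3 := hcorr 3
  rw [pacf_zero, hc (0 + 8) (by decide)] at c0
  rw [hc 1 (by decide), hc (1 + 8) (by decide)] at c1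
  rw [hc 2 (by decide), hc (2 + 8) (by decide)] at c2
  rw [hc 3 (by decide), hc (3 + 8) (by decide)] at c3
  simp only [hb.sq_eq_one] at c0
  simp [Fin.sum_univ_succ] at c0 c1 c2 c3 h₀ h₁ h₂ h₃ h₄ h₅ h₆ h₇
  have n₀ : b 8 - b 0 = -(2 * x₀) := by linarith
  have n₁ : b 9 - b 1 = -(2 * x₁) := by linarith
  have n₂ : b 10 - b 2 = -(2 * x₂) := by linarith
  have n₃ : b 11 - b 3 = -(2 * x₃) := by linarith
  have n₄ : b 12 - b 4 = -(2 * x₄) := by linarith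
  have n₅ : b 13 - b 5 = -(2 * x₅) := by linarith
  have n₆ : b 14 - b 6 = -(2 * x₆) := by linarith
  have n₇ : b 15 - b 7 = -(2 * x₇) := by linarith
  simp only [h₀, h₁, h₂, h₃, h₄, h₅, h₆, h₇,
    n₀, n₁, n₂, n₃, n₄, n₅, n₆, n₇] at c0 c1 c2 c3
  exact negacyclic_weight_four x₀ m₀ x₁ m₁ x₂ m₂ x₃ m₃ x₄ m₄ x₅ m₅ x₆ m₆
    x₇ m₇
    (by linarith) (by linarith) (by linarith) (by linarith)

/-! ### Explicit supplementary difference sets -/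

theorem existsSDS_4_1 :
    ExistsSDS 4 ![1] 0 :=
  existsSDS_of_digits ![1]
    (by decide +kernel)

theorem existsSDS_2_0_1 :
    ExistsSDS 2 ![0, 1] 0 :=
  existsSDS_of_digits ![0, 1]
    (by decide +kernel)

theorem existsSDS_10_4_3 :
    ExistsSDS 10 ![4, 3] 2 :=
  existsSDS_of_digits ![83, 11]
    (by decide +kernel)

theorem existsSDS_26_11_10 :
    ExistsSDS 26 ![11, 10] 8 :=
  existsSDS_of_digits ![832629, 562747]
    (by decide +kernel)

theorem existsSDS_34_13_16 :
    ExistsSDS 34 ![13, 16] 12 :=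
  existsSDS_of_digits ![41584451, 623273431]
    (by decide +kernel)

theorem existsSDS_50_22_21 :
    ExistsSDS 50 ![22, 21] 18 :=
  existsSDS_of_digits ![672301318151860, 881117297447472]
    (by decide +kernel)

theorem existsSDS_8_3_3_2 :
    ExistsSDS 8 ![3, 3, 2] 2 :=
  existsSDS_of_digits ![7, 37, 17]
    (by decide +kernel)

theorem existsSDS_12_3_6_6 :
    ExistsSDS 12 ![3, 6, 6] 6 :=
  existsSDS_of_digits ![7, 427, 619]
    (by decide +kernel)

theorem existsSDS_16_6_6_6 :
    ExistsSDS 16 ![6, 6, 6] 6 :=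
  existsSDS_of_digits ![215, 2443, 2707]
    (by decide +kernel)

theorem existsSDS_24_9_9_12 :
    ExistsSDS 24 ![9, 9, 12] 12 :=
  existsSDS_of_digits ![3417251, 225508, 13714357]
    (by decide +kernel)

theorem existsSDS_28_10_12_13 :
    ExistsSDS 28 ![10, 12, 13] 14 :=
  existsSDS_of_digits ![38077207, 134963641, 75738481]
    (by decide +kernel)

theorem existsSDS_32_12_14_14 :
    ExistsSDS 32 ![12, 14, 14] 16 :=
  existsSDS_of_digits ![2821399832, 1216823170, 610943971]
    (by decide +kernel)

theorem existsSDS_36_15_15_15 :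
    ExistsSDS 36 ![15, 15, 15] 18 :=
  existsSDS_of_digits ![51557341839, 37858616169, 8095304409]
    (by decide +kernel)

theorem existsSDS_40_19_18_15 :
    ExistsSDS 40 ![19, 18, 15] 22 :=
  existsSDS_of_digits ![618041854786, 434265715562, 659319702004]
    (by decide +kernel)

theorem existsSDS_44_20_20_17 :
    ExistsSDS 44 ![20, 20, 17] 24 :=
  existsSDS_of_digits ![7927464742963, 7435352449295, 6741506954527]
    (by decide +kernel)

theorem existsSDS_48_24_24_18 :
    ExistsSDS 48 ![24, 24, 18] 30 :=
  existsSDS_of_digits ![1543652094908, 119486084308213, 248706708328553]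
    (by decide +kernel)

theorem existsSDS_3_0_1_1_1 :
    ExistsSDS 3 ![0, 1, 1, 1] 0 :=
  existsSDS_of_digits ![0, 2, 4, 2]
    (by decide +kernel)

theorem existsSDS_5_1_1_2_2 :
    ExistsSDS 5 ![1, 1, 2, 2] 1 :=
  existsSDS_of_digits ![1, 8, 24, 18]
    (by decide +kernel)

theorem existsSDS_7_2_2_2_3 :
    ExistsSDS 7 ![2, 2, 2, 3] 2 :=
  existsSDS_of_digits ![36, 34, 80, 97]
    (by decide +kernel)

theorem existsSDS_9_3_3_3_3 :
    ExistsSDS 9 ![3, 3, 3, 3] 3 :=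
  existsSDS_of_digits ![268, 44, 322, 304]
    (by decide +kernel)

theorem existsSDS_11_3_4_4_5 :
    ExistsSDS 11 ![3, 4, 4, 5] 5 :=
  existsSDS_of_digits ![266, 1176, 705, 158]
    (by decide +kernel)

theorem existsSDS_13_4_5_5_5 :
    ExistsSDS 13 ![4, 5, 5, 5] 6 :=
  existsSDS_of_digits ![201, 3240, 4153, 2571]
    (by decide +kernel)

theorem existsSDS_15_5_5_6_7 :
    ExistsSDS 15 ![5, 5, 6, 7] 8 :=
  existsSDS_of_digits ![12880, 18467, 21104, 15633]
    (by decide +kernel)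

theorem existsSDS_17_6_6_7_7 :
    ExistsSDS 17 ![6, 6, 7, 7] 9 :=
  existsSDS_of_digits ![38022, 16775, 33205, 100491]
    (by decide +kernel)

theorem existsSDS_19_7_7_7_9 :
    ExistsSDS 19 ![7, 7, 7, 9] 11 :=
  existsSDS_of_digits ![110690, 168071, 182080, 283062]
    (by decide +kernel)

theorem existsSDS_21_8_8_8_9 :
    ExistsSDS 21 ![8, 8, 8, 9] 12 :=
  existsSDS_of_digits ![658758, 741414, 28428, 625546]
    (by decide +kernel)

theorem existsSDS_23_8_9_10_10 :
    ExistsSDS 23 ![8, 9, 10, 10] 14 :=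
  existsSDS_of_digits ![2344966, 5850630, 481923, 2410589]
    (by decide +kernel)

theorem existsSDS_25_10_10_10_10 :
    ExistsSDS 25 ![10, 10, 10, 10] 15 :=
  existsSDS_of_digits ![32153672, 13633477, 13791524, 21777505]
    (by decide +kernel)

theorem existsSDS_27_10_11_11_12 :
    ExistsSDS 27 ![10, 11, 11, 12] 17 :=
  existsSDS_of_digits ![4564268, 106456612, 24682610, 60823004]
    (by decide +kernel)

theorem existsSDS_29_11_11_13_13 :
    ExistsSDS 29 ![11, 11, 13, 13] 19 :=
  existsSDS_of_digits ![454040260, 177483360, 246973005, 423379779]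
    (by decide +kernel)

theorem existsSDS_31_12_13_13_13 :
    ExistsSDS 31 ![12, 13, 13, 13] 20 :=
  existsSDS_of_digits ![1242587388, 226906822, 111718212, 1489544219]
    (by decide +kernel)

theorem existsSDS_33_13_13_14_15 :
    ExistsSDS 33 ![13, 13, 14, 15] 22 :=
  existsSDS_of_digits ![8206274578, 5114564192, 120306209, 2795980428]
    (by decide +kernel)

theorem existsSDS_35_13_15_15_16 :
    ExistsSDS 35 ![13, 15, 15, 16] 24 :=
  existsSDS_of_digits ![21583790160, 3465924615, 12995179114, 7328264298]
    (by decide +kernel)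

theorem existsSDS_37_15_15_16_16 :
    ExistsSDS 37 ![15, 15, 16, 16] 25 :=
  existsSDS_of_digits ![18591370161, 40484616577, 70583550099, 62875009671]
    (by decide +kernel)

theorem existsSDS_39_16_16_16_18 :
    ExistsSDS 39 ![16, 16, 16, 18] 27 :=
  existsSDS_of_digits ![138097089555, 124571342217, 437031323858, 63944075412]
    (by decide +kernel)

theorem existsSDS_41_16_17_18_19 :
    ExistsSDS 41 ![16, 17, 18, 19] 29 :=
  existsSDS_of_digits ![56191216528, 1596204581125, 2071848068680, 1868807922722]
    (by decide +kernel)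

theorem existsSDS_43_18_18_18_19 :
    ExistsSDS 43 ![18, 18, 18, 19] 30 :=
  existsSDS_of_digits ![2225382271285, 3885659931459, 4575475401321, 8686645024131]
    (by decide +kernel)

theorem existsSDS_45_18_19_20_20 :
    ExistsSDS 45 ![18, 19, 20, 20] 32 :=
  existsSDS_of_digits ![12068195419024, 12170278800848, 2991768675973, 31344169368180]
    (by decide +kernel)

theorem existsSDS_47_19_20_20_22 :
    ExistsSDS 47 ![19, 20, 20, 22] 34 :=
  existsSDS_of_digits ![36184032359100, 37943140963254, 116449697932291, 137257676752040]
    (by decide +kernel)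

theorem existsSDS_49_21_21_21_21 :
    ExistsSDS 49 ![21, 21, 21, 21] 35 :=
  existsSDS_of_digits ![177043343150965, 401328347131672, 404907015648065, 53941125178208]
    (by decide +kernel)

theorem existsSDS_12_3_4_5_5_6 :
    ExistsSDS 12 ![3, 4, 5, 5, 6] 8 :=
  existsSDS_of_digits ![11, 2569, 1125, 1588, 3342]
    (by decide +kernel)

theorem existsSDS_20_7_8_8_8_8 :
    ExistsSDS 20 ![7, 8, 8, 8, 8] 14 :=
  existsSDS_of_digits ![352774, 297801, 116528, 557678, 722768]
    (by decide +kernel)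

theorem existsSDS_24_9_9_10_10_10 :
    ExistsSDS 24 ![9, 9, 10, 10, 10] 18 :=
  existsSDS_of_digits ![8403653, 8562970, 3736607, 3453489, 14758956]
    (by decide +kernel)

theorem existsSDS_28_11_11_11_12_12 :
    ExistsSDS 28 ![11, 11, 11, 12, 12] 22 :=
  existsSDS_of_digits ![40541232, 149606410, 41042236, 20146608, 208680360]
    (by decide +kernel)

theorem existsSDS_36_15_15_15_15_15 :
    ExistsSDS 36 ![15, 15, 15, 15, 15] 30 :=
  existsSDS_of_digits ![39737637437, 64899653122, 9471955386, 25856201933, 42968222970]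
    (by decide +kernel)

theorem existsSDS_44_21_20_19_18_17 :
    ExistsSDS 44 ![21, 20, 19, 18, 17] 40 :=
  existsSDS_of_digits ![6332233479494, 449144118646, 9846312558852, 6702637314638, 4638766493345]
    (by decide +kernel)

theorem existsSDS_48_23_21_21_20_19 :
    ExistsSDS 48 ![23, 21, 21, 20, 19] 44 :=
  existsSDS_of_digits ![184696050840896, 177795444269905, 19641357131986,
    225064446595146, 142272541606248]
    (by decide +kernel)

theorem existsSDS_6_1_2_2_2_2_2 :
    ExistsSDS 6 ![1, 2, 2, 2, 2, 2] 2 :=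
  existsSDS_of_digits ![4, 5, 36, 3, 40, 48]
    (by decide +kernel)

theorem existsSDS_14_5_5_5_5_5_6 :
    ExistsSDS 14 ![5, 5, 5, 5, 5, 6] 10 :=
  existsSDS_of_digits ![6466, 7177, 8970, 4380, 6736, 14016]
    (by decide +kernel)

theorem existsSDS_18_6_6_7_7_8_9 :
    ExistsSDS 18 ![6, 6, 7, 7, 8, 9] 16 :=
  existsSDS_of_digits ![26824, 102538, 184334, 41174, 91399, 181489]
    (by decide +kernel)

theorem existsSDS_22_8_8_8_9_10_10 :
    ExistsSDS 22 ![8, 8, 8, 9, 10, 10] 20 :=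
  existsSDS_of_digits ![3409995, 2543873, 156249, 2370183, 2259170, 181463]
    (by decide +kernel)

theorem existsSDS_30_12_12_12_12_12_15 :
    ExistsSDS 30 ![12, 12, 12, 12, 12, 15] 30 :=
  existsSDS_of_digits ![303416490, 842016403, 1008014364, 965677092, 135159433, 601439056]
    (by decide +kernel)

theorem existsSDS_38_18_17_16_16_16_14 :
    ExistsSDS 38 ![18, 17, 16, 16, 16, 14] 40 :=
  existsSDS_of_digits ![23313655930, 51884247542, 5523768781,
    182044476984, 34715143278, 156231796983]
    (by decide +kernel)

theorem existsSDS_42_19_18_18_18_17_17 :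
    ExistsSDS 42 ![19, 18, 18, 18, 17, 17] 44 :=
  existsSDS_of_digits ![1388018282746, 2683772355400, 3656490590272,
    1371222323362, 277966793422, 14715755315]
    (by decide +kernel)

theorem existsSDS_46_21_21_21_21_21_16 :
    ExistsSDS 46 ![21, 21, 21, 21, 21, 16] 52 :=
  existsSDS_of_digits ![2118850040353, 54480975857158, 59599052876678,
    4470768628015, 58518976401046, 52811596737545]
    (by decide +kernel)

/-! ### Existence -/

theorem existsPCS_four_of_odd {N : ℕ} (hN : N ≤ 50) (hodd : N % 2 = 1) : ExistsPCS 4 N := by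
  interval_cases N <;> first | omega | skip
  exacts [existsPCS_one_right 4,
    existsSDS_3_0_1_1_1.existsPCS (by decide),
    existsSDS_5_1_1_2_2.existsPCS (by decide),
    existsSDS_7_2_2_2_3.existsPCS (by decide),
    existsSDS_9_3_3_3_3.existsPCS (by decide),
    existsSDS_11_3_4_4_5.existsPCS (by decide),
    existsSDS_13_4_5_5_5.existsPCS (by decide),
    existsSDS_15_5_5_6_7.existsPCS (by decide),
    existsSDS_17_6_6_7_7.existsPCS (by decide),
    existsSDS_19_7_7_7_9.existsPCS (by decide),
    existsSDS_21_8_8_8_9.existsPCS (by decide),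
    existsSDS_23_8_9_10_10.existsPCS (by decide),
    existsSDS_25_10_10_10_10.existsPCS (by decide),
    existsSDS_27_10_11_11_12.existsPCS (by decide),
    existsSDS_29_11_11_13_13.existsPCS (by decide),
    existsSDS_31_12_13_13_13.existsPCS (by decide),
    existsSDS_33_13_13_14_15.existsPCS (by decide),
    existsSDS_35_13_15_15_16.existsPCS (by decide),
    existsSDS_37_15_15_16_16.existsPCS (by decide),
    existsSDS_39_16_16_16_18.existsPCS (by decide),
    existsSDS_41_16_17_18_19.existsPCS (by decide),
    existsSDS_43_18_18_18_19.existsPCS (by decide),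
    existsSDS_45_18_19_20_20.existsPCS (by decide),
    existsSDS_47_19_20_20_22.existsPCS (by decide),
    existsSDS_49_21_21_21_21.existsPCS (by decide)]

theorem existsPCS_four {N : ℕ} (h0 : 1 ≤ N) (hN : N ≤ 50) : ExistsPCS 4 N := by
  induction N using Nat.strong_induction_on with
  | _ N ih =>
    rcases Nat.even_or_odd' N with ⟨k, rfl | rfl⟩
    · rw [Nat.mul_comm]
      exact (ih k (by omega) (by omega) (by omega)).double_length (k := 2)
    · exact existsPCS_four_of_odd hN (by omega)

theorem existsPCS_of_four_dvd {p N : ℕ} (hp : 4 ∣ p) (h0 : 1 ≤ N) (hN : N ≤ 50) :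
    ExistsPCS p N := by
  obtain ⟨k, rfl⟩ := hp
  rw [Nat.mul_comm]
  exact (existsPCS_four h0 hN).mul_left k

theorem existsPCS_two_double {N : ℕ} (h : ExistsPCS 2 N) : ExistsPCS 2 (N * 2) :=
  h.double_length (k := 1)

theorem existsPCS_of_mem_bulletColumns {p N : ℕ} (h : N ∈ bulletColumns p) : ExistsPCS p N := by
  have h2 : ExistsPCS 2 2 := existsSDS_2_0_1.existsPCS (by decide)
  have h10 : ExistsPCS 2 10 := existsSDS_10_4_3.existsPCS (by decide)
  have h8 : ExistsPCS 2 8 := existsPCS_two_double (existsPCS_two_double h2)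
  have h16 : ExistsPCS 2 16 := existsPCS_two_double h8
  have h20 : ExistsPCS 2 20 := existsPCS_two_double h10
  unfold bulletColumns at h
  split at h <;> simp only [List.mem_cons, List.not_mem_nil, or_false] at h
  · subst h
    exact existsSDS_4_1.existsPCS (by decide)
  · rcases h with rfl | rfl | rfl | rfl | rfl | rfl | rfl | rfl | rfl | rfl
    exacts [h2, h8, h10, h16, h20, existsSDS_26_11_10.existsPCS (by decide),
      existsPCS_two_double h16, existsSDS_34_13_16.existsPCS (by decide), existsPCS_two_double h20,
      existsSDS_50_22_21.existsPCS (by decide)]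
  · rcases h with rfl | rfl | rfl | rfl | rfl | rfl | rfl | rfl | rfl | rfl
    exacts [existsSDS_8_3_3_2.existsPCS (by decide),
      existsSDS_12_3_6_6.existsPCS (by decide),
      existsSDS_16_6_6_6.existsPCS (by decide),
      existsSDS_24_9_9_12.existsPCS (by decide),
      existsSDS_28_10_12_13.existsPCS (by decide),
      existsSDS_32_12_14_14.existsPCS (by decide),
      existsSDS_36_15_15_15.existsPCS (by decide),
      existsSDS_40_19_18_15.existsPCS (by decide),
      existsSDS_44_20_20_17.existsPCS (by decide),
      existsSDS_48_24_24_18.existsPCS (by decide)]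
  · rcases h with rfl | rfl | rfl | rfl | rfl | rfl | rfl
    exacts [existsSDS_12_3_4_5_5_6.existsPCS (by decide),
      existsSDS_20_7_8_8_8_8.existsPCS (by decide),
      existsSDS_24_9_9_10_10_10.existsPCS (by decide),
      existsSDS_28_11_11_11_12_12.existsPCS (by decide),
      existsSDS_36_15_15_15_15_15.existsPCS (by decide),
      existsSDS_44_21_20_19_18_17.existsPCS (by decide),
      existsSDS_48_23_21_21_20_19.existsPCS (by decide)]
  · rcases h with rfl | rfl | rfl | rfl | rfl | rfl | rfl | rfl
    exacts [existsSDS_6_1_2_2_2_2_2.existsPCS (by decide),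
      existsSDS_14_5_5_5_5_5_6.existsPCS (by decide),
      existsSDS_18_6_6_7_7_8_9.existsPCS (by decide),
      existsSDS_22_8_8_8_9_10_10.existsPCS (by decide),
      existsSDS_30_12_12_12_12_12_15.existsPCS (by decide),
      existsSDS_38_18_17_16_16_16_14.existsPCS (by decide),
      existsSDS_42_19_18_18_18_17_17.existsPCS (by decide),
      existsSDS_46_21_21_21_21_21_16.existsPCS (by decide)]

/-! ### Non-existence -/

/-- The witnesses are the absolute values of the sums of the sequences; natural numbers allow a
bounded search. -/
theorem ExistsPCS.exists_sum_sq_eq {p N : ℕ} (hN : N ≠ 0) (h : ExistsPCS p N) :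
    ∃ x : Fin p → ℕ, ∑ r, x r ^ 2 = p * N := by
  obtain ⟨n, rfl⟩ := Nat.exists_eq_succ_of_ne_zero hN
  obtain ⟨a, ha⟩ := h
  refine ⟨fun r => (∑ j, a r j).natAbs, ?_⟩
  have h := ha.sum_sq_sum_eq
  zify
  simpa only [sq_abs, Nat.cast_succ] using h

theorem not_existsPCS_two_eighteen : ¬ ExistsPCS 2 18 := fun h =>
  not_existsPCS_two_thirtySix (existsPCS_two_double h)

theorem not_existsPCS_one_thirtySix : ¬ ExistsPCS 1 36 := fun h =>
  not_existsPCS_two_thirtySix (h.add h)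

/-- Here `60 = 4 * (8 + 7)` is not a sum of three squares. -/
theorem not_existsPCS_three_twenty : ¬ ExistsPCS 3 20 := fun h => by
  obtain ⟨x, hx⟩ := h.exists_sum_sq_eq (by norm_num)
  rw [Fin.sum_univ_three] at hx
  have h0 : x 0 < 8 := by nlinarith
  have h1 : x 1 < 8 := by nlinarith
  have h2 : x 2 < 8 := by nlinarith
  have key : ∀ u < 8, ∀ v < 8, ∀ w < 8, u ^ 2 + v ^ 2 + w ^ 2 ≠ 3 * 20 := by decide
  exact key _ h0 _ h1 _ h2 hx

theorem eq_of_existsPCS_one {N : ℕ} (h1 : 1 < N) (hN : N ≤ 50) (heven : Even N)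
    (h : ExistsPCS 1 N) : N = 4 ∨ N = 16 ∨ N = 36 := by
  obtain ⟨x, hx⟩ := h.exists_sum_sq_eq (by omega)
  rw [Fin.sum_univ_one] at hx
  have h0 : x 0 < 8 := by nlinarith
  generalize x 0 = u at hx h0
  have h2 := heven.two_dvd
  interval_cases u <;> omega

set_option synthInstance.maxSize 2000 in
theorem mem_of_existsPCS_two {N : ℕ} (h1 : 1 < N) (hN : N ≤ 50) (heven : Even N)
    (h : ExistsPCS 2 N) :
    N ∈ bulletColumns 2 ∨ N = 4 ∨ N = 18 ∨ N = 36 := by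
  obtain ⟨x, hx⟩ := h.exists_sum_sq_eq (by omega)
  rw [Fin.sum_univ_two] at hx
  have h0 : x 0 < 11 := by nlinarith
  have h1 : x 1 < 11 := by nlinarith
  have key : ∀ u < 11, ∀ v < 11, ∀ N < 51, 1 < N → N % 2 = 0 → u ^ 2 + v ^ 2 = 2 * N →
      N ∈ bulletColumns 2 ∨ N = 4 ∨ N = 18 ∨ N = 36 := by decide +kernel
  exact key _ h0 _ h1 N (by omega) (by omega) (Nat.even_iff.1 heven) hx

set_option synthInstance.maxSize 2000 in
-- Confines the blank entries not settled modulo 4 to rows 1 and 2 and one entry of row 3.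
theorem eq_of_tableEntry_eq_blank : ∀ p < 13, ∀ N < 51, (1 ≤ p ∧ ¬ 4 ∣ p ∧ 1 < N ∧ N % 2 = 0 ∧
    tableEntry p N = .blank ∧ 4 ∣ p * N) → p = 1 ∨ p = 2 ∨ p = 3 ∧ N = 20 := by
  decide +kernel

theorem not_existsPCS_of_blank {p N : ℕ} (hp1 : 1 ≤ p) (hp : p ≤ 12) (h4 : ¬ 4 ∣ p) (hN1 : 1 < N)
    (hN : N ≤ 50) (heven : Even N) (hb : tableEntry p N = .blank) : ¬ ExistsPCS p N := by
  intro h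
  rcases eq_of_tableEntry_eq_blank p (by omega) N (by omega)
    ⟨hp1, h4, hN1, Nat.even_iff.1 heven, hb, h.four_dvd_mul hN1⟩ with rfl | rfl | ⟨rfl, rfl⟩
  · rcases eq_of_existsPCS_one hN1 hN heven h with rfl | rfl | rfl
    · exact absurd hb (by decide)
    · exact not_existsPCS_one_sixteen h
    · exact not_existsPCS_one_thirtySix h
  · rcases mem_of_existsPCS_two hN1 hN heven h with hmem | rfl | rfl | rfl
    · simp [tableEntry, hmem] at hb
    · exact absurd hb (by decide)
    · exact not_existsPCS_two_eighteen h
    · exact not_existsPCS_two_thirtySix h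
  · exact not_existsPCS_three_twenty h

/-! ### Combinations -/

theorem existsPCS_of_bullet {p N : ℕ} (h : tableEntry p N = .bullet) : ExistsPCS p N := by
  unfold tableEntry at h
  split_ifs at h with hb
  exact existsPCS_of_mem_bulletColumns hb

theorem IsCombination.existsPCS {p N : ℕ} (h0 : 1 ≤ N) (hN : N ≤ 50) (h : IsCombination p N) :
    ExistsPCS p N := by
  obtain ⟨s, rfl, hs⟩ := h
  refine existsPCS_multiset_sum s fun q hq => ?_
  rcases (hs q hq).2 with rfl | hb
  exacts [existsPCS_four h0 hN, existsPCS_of_bullet hb]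

set_option synthInstance.maxSize 2000 in
theorem isCombination_of_circle {p N : ℕ} (hp : p ≤ 12) (hN : N ≤ 50)
    (h : tableEntry p N = .circle) : IsCombination p N := by
  -- These twenty decompositions cover all circle entries.
  have key : ∀ p < 13, ∀ N < 51, tableEntry p N = .circle →
      ∃ l ∈ [[1, 1], [1, 1, 1], [1, 4], [2, 3], [2, 2, 2], [1, 1, 1, 1, 1, 1], [3, 3],
        [1, 1, 1, 4], [3, 4], [2, 5], [1, 4, 4], [3, 3, 3], [4, 5], [4, 6], [2, 2, 2, 4],
        [3, 3, 4], [1, 1, 4, 4], [3, 4, 4], [2, 4, 5], [1, 1, 1, 4, 4]],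
        l.sum = p ∧ ∀ q ∈ l, q < p ∧ (q = 4 ∨ tableEntry q N = .bullet) := by
    decide +kernel
  obtain ⟨l, -, hl, hq⟩ := key p (by omega) N (by omega) h
  exact ⟨l, by simpa using hl, by simpa using hq⟩

set_option synthInstance.maxSize 2000 in
-- Either all admissible parts share a divisor 4 or 2 that `p` lacks, or they lie in `{3, 4}` and `p
-- = 5`, which is too large for one part and too small for two.
theorem not_isCombination_of_bullet {p N : ℕ} (hp : p ≤ 12) (hN : N ≤ 50)
    (h : tableEntry p N = .bullet) : ¬ IsCombination p N := by
  have key : ∀ p < 13, ∀ N < 51, tableEntry p N = .bullet →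
      ((∀ q < p, (q = 4 ∨ tableEntry q N = .bullet) → 4 ∣ q) ∧ ¬ 4 ∣ p) ∨
      ((∀ q < p, (q = 4 ∨ tableEntry q N = .bullet) → 2 ∣ q) ∧ ¬ 2 ∣ p) ∨
      ((∀ q < p, (q = 4 ∨ tableEntry q N = .bullet) → 3 ≤ q ∧ q ≤ 4) ∧ p = 5) := by
    decide +kernel
  rintro ⟨s, hs, hq⟩
  rcases key p (by omega) N (by omega) h with ⟨hd, hnd⟩ | ⟨hd, hnd⟩ | ⟨hd, rfl⟩
  · exact hnd (hs ▸ Multiset.dvd_sum fun q hqs => hd q (hq q hqs).1 (hq q hqs).2)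
  · exact hnd (hs ▸ Multiset.dvd_sum fun q hqs => hd q (hq q hqs).1 (hq q hqs).2)
  · have h1 := Multiset.card_nsmul_le_sum fun q hqs => (hd q (hq q hqs).1 (hq q hqs).2).1
    have h2 := Multiset.sum_le_card_nsmul s 4 fun q hqs => (hd q (hq q hqs).1 (hq q hqs).2).2
    simp only [hs, smul_eq_mul] at h1 h2
    omega

end PeriodicComplementary

theorem mainTheorem1 :
    -- rows with `4 ∣ p`: always existence
    (∀ p N : ℕ, 1 ≤ p → 4 ∣ p → 1 ≤ N → N ≤ 50 → ExistsPCS p N) ∧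
    -- length one: always existence
    (∀ p : ℕ, 1 ≤ p → ExistsPCS p 1) ∧
    -- otherwise the length has to be even
    (∀ p N : ℕ, ¬ 4 ∣ p → 1 < N → ExistsPCS p N → Even N) ∧
    -- the table decides existence for even lengths
    (∀ p N : ℕ, 1 ≤ p → p ≤ 12 → ¬ 4 ∣ p → 1 < N → N ≤ 50 → Even N →
      (tableEntry p N = .blank → ¬ ExistsPCS p N) ∧
      (tableEntry p N = .bullet → ExistsPCS p N ∧ ¬ IsCombination p N) ∧
      (tableEntry p N = .circle → ExistsPCS p N ∧ IsCombination p N)) ∧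
    -- the supplementary difference sets that settle the formerly undecided cases
    (ExistsSDS 36 ![15, 15, 15] 18 ∧
      ExistsSDS 40 ![19, 18, 15] 22 ∧
      ExistsSDS 44 ![20, 20, 17] 24 ∧
      ExistsSDS 48 ![24, 24, 18] 30 ∧
      ExistsSDS 44 ![21, 20, 19, 18, 17] 40 ∧
      ExistsSDS 48 ![23, 21, 21, 20, 19] 44 ∧
      ExistsSDS 38 ![18, 17, 16, 16, 16, 14] 40 ∧
      ExistsSDS 42 ![19, 18, 18, 18, 17, 17] 44 ∧
      ExistsSDS 46 ![21, 21, 21, 21, 21, 16] 52) := by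
  refine ⟨fun p N _ hp h0 hN => existsPCS_of_four_dvd hp h0 hN, fun p _ => existsPCS_one_right p,
    fun p N hp hN h => ?_, fun p N hp1 hp h4 hN1 hN heven => ⟨?_, ?_, ?_⟩,
    existsSDS_36_15_15_15, existsSDS_40_19_18_15, existsSDS_44_20_20_17, existsSDS_48_24_24_18,
    existsSDS_44_21_20_19_18_17, existsSDS_48_23_21_21_20_19, existsSDS_38_18_17_16_16_16_14,
    existsSDS_42_19_18_18_18_17_17, existsSDS_46_21_21_21_21_21_16⟩
  · by_contra hodd
    have hcop : Nat.Coprime 4 N := by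
      rw [Nat.not_even_iff_odd] at hodd
      exact Nat.Coprime.pow_left 2 (Nat.coprime_two_left.2 hodd)
    exact hp (hcop.dvd_of_dvd_mul_right (h.four_dvd_mul hN))
  · exact not_existsPCS_of_blank hp1 hp h4 hN1 hN heven
  · exact fun h => ⟨existsPCS_of_bullet h, not_isCombination_of_bullet hp hN h⟩
  · exact fun h => have hc := isCombination_of_circle hp hN h
      ⟨hc.existsPCS hN1.le hN, hc⟩
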